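/- Let $U=\{x\in\mathbb C: -\tfrac12\le \mathrm{Re}(x)<\tfrac12,\ -\tfrac12\le \mathrm{Im}(x)<\tfrac12\}$. For $z\in\mathbb C$ put $[z]=\lfloor \mathrm{Re}(z)+\tfrac12\rfloor+\sqrt{-1}\,\lfloor \mathrm{Im}(z)+\tfrac12\rfloor$, and for $z\in U\setminus\{0\}$ put $T(z)=\tfrac1z-[\tfrac1z]\in U$. For $x\in U\setminus\mathbb Q(\sqrt{-1})$ all iterates $T^{n}(x)$, $n\ge 0$, are defined and nonzero, and the partial quotients of the Hurwitz continued fraction expansion of $x$ are the Gaussian integers $c_n(x)=[1/T^{n-1}(x)]$, $n\ge1$. Write $\|z\|_\infty=\max\{|\mathrm{Re}(z)|,|\mathrm{Im}(z)|\}$ and let \[ E=\{x\in U\setminus\mathbb Q(\sqrt{-1}) : c_m(x)\ne c_n(x)\text{ for all } m,n\ge 1 \text{ with } m\neq n\}, \] \[ S=\{x\in U\setminus\mathbb Q(\sqrt{-1}) : 3^n\le\|c_n(x)\|_\infty<2\cdot 3^n\text{ for all } n\ge1\}. \] Then $S\subset E$, and the Hausdorff dimension of $S$, with respect to the Euclidean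 metric on $\mathbb C=\mathbb R^2$, is at least $1$. -/

import Mathlib

noncomputable section

namespace Hurwitz

/-- The half-open unit square `U` centred at the origin. -/
def U : Set ℂ :=
  {x | -(1 / 2 : ℝ) ≤ x.re ∧ x.re < 1 / 2 ∧ -(1 / 2 : ℝ) ≤ x.im ∧ x.im < 1 / 2}

/-- The Gaussian field `ℚ(i)`, identified with `ℚ²`, as a subset of `ℂ`. -/
def ratPoints : Set ℂ :=
  {x | ∃ p q : ℚ, x = (p : ℂ) + (q : ℂ) * Complex.I}

/-- The Gaussian integer `c` with `z - c ∈ U`. -/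
def nearest (z : ℂ) : GaussianInt :=
  ⟨⌊z.re + 1 / 2⌋, ⌊z.im + 1 / 2⌋⟩

/-- The Hurwitz map `z ↦ 1 / z - nearest (1 / z)`, with the value `0` at `z = 0`. It maps
`U \ ratPoints` into itself, so that `0` is not met on the orbits of interest. -/
def hurwitzMap (z : ℂ) : ℂ :=
  z⁻¹ - (nearest z⁻¹ : ℂ)

/-- The `n`-th partial quotient `c_n(x)`, for `n ≥ 1`, of the Hurwitz continued fraction
expansion of `x ∈ U \ ratPoints`. -/
def partialQuotient (x : ℂ) (n : ℕ) : GaussianInt :=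
  nearest (hurwitzMap^[n - 1] x)⁻¹

/-- The maximum norm on `ℂ = ℝ²`. -/
def maxNorm (x : ℂ) : ℝ := max |x.re| |x.im|

/-- The set `E` of complex irrationals in `U` with pairwise distinct partial quotients. -/
def E : Set ℂ :=
  {x | x ∈ U \ ratPoints ∧
    ∀ m n : ℕ, 1 ≤ m → 1 ≤ n → m ≠ n → partialQuotient x m ≠ partialQuotient x n}

/-- The seed set `S`. -/
def seedSet : Set ℂ :=
  {x | x ∈ U \ ratPoints ∧
    ∀ n : ℕ, 1 ≤ n → (3 : ℝ) ^ n ≤ maxNorm (partialQuotient x n) ∧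
      maxNorm (partialQuotient x n) < 2 * (3 : ℝ) ^ n}

end Hurwitz

end

open Filter Topology
open scoped NNReal ENNReal

noncomputable section

namespace Hurwitz

/-! The ranges `[3^n, 2 * 3^n)` are disjoint, so the partial quotients are distinct. For the
dimension, `t` in `[0, 1)` is expanded in mixed radix `9, 9^2, …`, and its `k`-th digit selects one
of `9^k` admissible Gaussian integers. If `t` and `u` first differ at index `n`, then `|t - u| <
3^(-n(n+1))`, while `le_norm_value_sub` keeps the values at least `3^(-n(n+1) - 4(n+1)) / 5` apart.
The quadratic terms agree and the linear loss is absorbed by any exponent `s < 1`, so the inverse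
coding is `s`-Hölder and the image has dimension at least `s`. -/

theorem seedSet_subset_E : seedSet ⊆ E := by
  rintro x ⟨hx, h⟩
  have key : ∀ m n : ℕ, 1 ≤ m → m < n → partialQuotient x m ≠ partialQuotient x n := by
    intro m n hm hmn heq
    have h1 := (h m hm).2
    have h2 := (h n (by omega)).1
    rw [heq] at h1
    have h3 : (3 : ℝ) ^ (m + 1) ≤ 3 ^ n := pow_le_pow_right₀ (by norm_num) hmn
    have h4 : (0 : ℝ) < 3 ^ m := by positivity
    rw [pow_succ] at h3
    linarith
  refine ⟨hx, fun m n hm hn hne => ?_⟩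
  rcases lt_or_gt_of_ne hne with hlt | hlt
  · exact key m n hm hlt
  · exact (key n m hn hlt).symm

theorem countable_ratPoints : ratPoints.Countable := by
  have : ratPoints = Set.range fun r : ℚ × ℚ => (r.1 : ℂ) + (r.2 : ℂ) * Complex.I := by
    ext x
    simp [ratPoints, eq_comm]
  rw [this]
  exact Set.countable_range _

/-! ### Continued fractions with large partial quotients -/

/-- The `k`-th convergent of the continued fraction with partial quotients `c 0, c 1, …`. -/
def convergent : ℕ → (ℕ → GaussianInt) → ℂ
  | 0, _ => 0
  | k + 1, c => ((c 0 : ℂ) + convergent k fun i => c (i + 1))⁻¹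

/-- The value of the continued fraction with partial quotients `c 0, c 1, …`. -/
def value (c : ℕ → GaussianInt) : ℂ := limUnder atTop fun k => convergent k c

/-- All terms of the sequence have absolute value at least three. -/
def IsLarge (c : ℕ → GaussianInt) : Prop := ∀ k, 3 ≤ ‖(c k : ℂ)‖

theorem IsLarge.tail {c : ℕ → GaussianInt} (hc : IsLarge c) : IsLarge fun i => c (i + 1) :=
  fun k => hc (k + 1)

theorem le_norm_add {a z : ℂ} (ha : 3 ≤ ‖a‖) (hz : ‖z‖ ≤ 2 / 5) : 5 / 2 ≤ ‖a + z‖ := by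
  have := norm_sub_le_norm_add a z
  linarith

/-- The disc of radius `2 / 5` is stable because `1 / (3 - 2/5) < 2/5`. As `2/5 < 1/2`, rounding
recovers each partial quotient. -/
theorem norm_convergent_le (k : ℕ) :
    ∀ {c : ℕ → GaussianInt}, IsLarge c → ‖convergent k c‖ ≤ 2 / 5 := by
  induction k with
  | zero => intro c _; norm_num [convergent]
  | succ k ih =>
    intro c hc
    rw [convergent, norm_inv]
    have h := le_norm_add (hc 0) (ih hc.tail)
    calc _ ≤ (5 / 2 : ℝ)⁻¹ := inv_anti₀ (by norm_num) h
      _ = 2 / 5 := by norm_num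

theorem norm_inv_sub_inv {a b : ℂ} (ha : a ≠ 0) (hb : b ≠ 0) :
    ‖a⁻¹ - b⁻¹‖ = ‖a - b‖ / (‖a‖ * ‖b‖) := by
  rw [inv_sub_inv ha hb, norm_div, norm_mul, norm_sub_rev]

theorem ne_zero_of_le_norm {a : ℂ} (h : 5 / 2 ≤ ‖a‖) : a ≠ 0 :=
  norm_pos_iff.1 (by linarith)

theorem dist_convergent_succ_le (k : ℕ) :
    ∀ {c : ℕ → GaussianInt}, IsLarge c →
      dist (convergent k c) (convergent (k + 1) c) ≤ 1 * (1 / 2) ^ k := by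
  induction k with
  | zero =>
    intro c hc
    have := norm_convergent_le 1 hc
    rw [convergent, dist_zero_left]
    norm_num
    linarith
  | succ k ih =>
    intro c hc
    have h := ih hc.tail
    have h1 := le_norm_add (hc 0) (norm_convergent_le k hc.tail)
    have h2 := le_norm_add (hc 0) (norm_convergent_le (k + 1) hc.tail)
    rw [convergent, convergent, dist_eq_norm,
      norm_inv_sub_inv (ne_zero_of_le_norm h1) (ne_zero_of_le_norm h2), add_sub_add_left_eq_sub,
      ← dist_eq_norm]
    rw [div_le_iff₀ (by positivity)]
    have h3 : (2 : ℝ) ≤ ‖(c 0 : ℂ) + convergent k fun i => c (i + 1)‖ *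
        ‖(c 0 : ℂ) + convergent (k + 1) fun i => c (i + 1)‖ := by nlinarith
    calc _ ≤ 1 * (1 / 2 : ℝ) ^ k := h
      _ = 1 * (1 / 2) ^ (k + 1) * 2 := by ring
      _ ≤ _ := by gcongr

theorem tendsto_convergent {c : ℕ → GaussianInt} (hc : IsLarge c) :
    Tendsto (fun k => convergent k c) atTop (𝓝 (value c)) :=
  (cauchySeq_of_le_geometric (1 / 2) 1 (by norm_num)
    fun k => dist_convergent_succ_le k hc).tendsto_limUnder

theorem norm_value_le {c : ℕ → GaussianInt} (hc : IsLarge c) : ‖value c‖ ≤ 2 / 5 :=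
  le_of_tendsto (tendsto_convergent hc).norm (.of_forall fun k => norm_convergent_le k hc)

theorem le_norm_add_value {c : ℕ → GaussianInt} (hc : IsLarge c) :
    5 / 2 ≤ ‖(c 0 : ℂ) + value fun i => c (i + 1)‖ :=
  le_norm_add (hc 0) (norm_value_le hc.tail)

theorem value_eq {c : ℕ → GaussianInt} (hc : IsLarge c) :
    value c = ((c 0 : ℂ) + value fun i => c (i + 1))⁻¹ :=
  tendsto_nhds_unique ((tendsto_convergent hc).comp (tendsto_add_atTop_nat 1))
    (((tendsto_convergent hc.tail).const_add _).inv₀ (ne_zero_of_le_norm (le_norm_add_value hc)))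

theorem nearest_add {z : ℂ} (g : GaussianInt) (hz : ‖z‖ ≤ 2 / 5) : nearest (g + z) = g := by
  have h1 := abs_le.1 ((Complex.abs_re_le_norm z).trans hz)
  have h2 := abs_le.1 ((Complex.abs_im_le_norm z).trans hz)
  apply Zsqrtd.ext
  · simp only [nearest, Complex.add_re, ← GaussianInt.intCast_re, Int.floor_eq_iff]
    constructor <;> linarith [h1.1, h1.2]
  · simp only [nearest, Complex.add_im, ← GaussianInt.intCast_im, Int.floor_eq_iff]
    constructor <;> linarith [h2.1, h2.2]

theorem nearest_inv_value {c : ℕ → GaussianInt} (hc : IsLarge c) :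
    nearest (value c)⁻¹ = c 0 := by
  rw [value_eq hc, inv_inv, nearest_add _ (norm_value_le hc.tail)]

theorem hurwitzMap_value {c : ℕ → GaussianInt} (hc : IsLarge c) :
    hurwitzMap (value c) = value fun i => c (i + 1) := by
  rw [hurwitzMap, nearest_inv_value hc, value_eq hc, inv_inv, add_sub_cancel_left]

theorem nearest_inv_iterate_hurwitzMap (k : ℕ) :
    ∀ {c : ℕ → GaussianInt}, IsLarge c → nearest (hurwitzMap^[k] (value c))⁻¹ = c k := by
  induction k with
  | zero => exact fun hc => nearest_inv_value hc
  | succ k ih =>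
    intro c hc
    rw [Function.iterate_succ_apply, hurwitzMap_value hc, ih hc.tail]

theorem value_mem_U {c : ℕ → GaussianInt} (hc : IsLarge c) : value c ∈ U := by
  have h1 := abs_le.1 ((Complex.abs_re_le_norm _).trans (norm_value_le hc))
  have h2 := abs_le.1 ((Complex.abs_im_le_norm _).trans (norm_value_le hc))
  refine ⟨?_, ?_, ?_, ?_⟩ <;> linarith [h1.1, h1.2, h2.1, h2.2]

theorem one_le_norm_sub {g h : GaussianInt} (hgh : g ≠ h) : 1 ≤ ‖(g : ℂ) - h‖ := by
  rw [← GaussianInt.toComplex_sub, ← one_le_sq_iff₀ (norm_nonneg _), ← Complex.normSq_eq_norm_sq,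
    ← GaussianInt.intCast_real_norm]
  exact_mod_cast Int.add_one_le_iff.2 (GaussianInt.norm_pos.2 (sub_ne_zero.2 hgh))

/-- Each inversion divides the distance by the product of two denominators, at most `B k ^ 2`. At
the first disagreement the Gaussian integers are at least `1` apart and the tails take away at most
`2 * (2/5)`, leaving `1 / 5`. -/
theorem le_norm_value_sub (n : ℕ) : ∀ {c d : ℕ → GaussianInt} {B : ℕ → ℝ},
    IsLarge c → IsLarge d → (∀ k, ‖(c k : ℂ)‖ + 2 / 5 ≤ B k) → (∀ k, ‖(d k : ℂ)‖ + 2 / 5 ≤ B k) →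
    (∀ k < n, c k = d k) → c n ≠ d n →
    1 / 5 ≤ ‖value c - value d‖ * ∏ k ∈ Finset.range (n + 1), B k ^ 2 := by
  induction n with
  | zero =>
    intro c d B hc hd hcB hdB _ hne
    have h1 := le_norm_add_value hc
    have h2 := le_norm_add_value hd
    have h3 := (norm_add_le (c 0 : ℂ) (value fun i => c (i + 1))).trans
      ((add_le_add_right (norm_value_le hc.tail) _).trans (hcB 0))
    have h4 := (norm_add_le (d 0 : ℂ) (value fun i => d (i + 1))).trans
      ((add_le_add_right (norm_value_le hd.tail) _).trans (hdB 0))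
    rw [value_eq hc, value_eq hd, norm_inv_sub_inv (ne_zero_of_le_norm h1) (ne_zero_of_le_norm h2)]
    have h5 : 1 / 5 ≤ ‖(c 0 : ℂ) + (value fun i => c (i + 1)) -
        (d 0 + value fun i => d (i + 1))‖ := by
      have e1 := one_le_norm_sub hne
      have e2 := norm_sub_le_norm_add ((c 0 : ℂ) - d 0)
        ((value fun i => c (i + 1)) - value fun i => d (i + 1))
      have e3 := norm_sub_le (value fun i => c (i + 1)) (value fun i => d (i + 1))
      have e4 := norm_value_le hc.tail
      have e5 := norm_value_le hd.tail
      rw [add_sub_add_comm]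
      linarith
    have hB : 0 ≤ B 0 := (norm_nonneg _).trans h3
    rw [zero_add, Finset.prod_range_one, div_mul_eq_mul_div, le_div_iff₀ (by positivity), sq]
    gcongr
  | succ n ih =>
    intro c d B hc hd hcB hdB heq hne
    have h := ih (B := fun k => B (k + 1)) hc.tail hd.tail (fun k => hcB (k + 1))
      (fun k => hdB (k + 1)) (fun k hk => heq (k + 1) (by omega)) hne
    have h1 := le_norm_add_value hc
    have h2 := le_norm_add_value hd
    have h3 := (norm_add_le (c 0 : ℂ) (value fun i => c (i + 1))).trans
      ((add_le_add_right (norm_value_le hc.tail) _).trans (hcB 0))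
    have h4 := (norm_add_le (d 0 : ℂ) (value fun i => d (i + 1))).trans
      ((add_le_add_right (norm_value_le hd.tail) _).trans (hdB 0))
    rw [value_eq hc, value_eq hd, norm_inv_sub_inv (ne_zero_of_le_norm h1) (ne_zero_of_le_norm h2),
      heq 0 n.succ_pos, add_sub_add_left_eq_sub, ← heq 0 n.succ_pos, Finset.prod_range_succ',
      div_mul_eq_mul_div, ← mul_assoc]
    have hB : 0 ≤ B 0 := (norm_nonneg _).trans h3
    rw [← heq 0 n.succ_pos] at h2 h4
    rw [le_div_iff₀ (mul_pos (by linarith) (by linarith))]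
    refine mul_le_mul h ?_ (by positivity) (by linarith)
    rw [sq]
    gcongr

/-! ### The coding of the unit interval -/

/-- The number of admissible choices for the first `k` partial quotients. -/
def blockCount (k : ℕ) : ℕ := 3 ^ (k * (k + 1))

theorem blockCount_succ (k : ℕ) : blockCount (k + 1) = blockCount k * 9 ^ (k + 1) := by
  rw [blockCount, blockCount, show (9 : ℕ) = 3 ^ 2 by norm_num, ← pow_mul, ← pow_add]
  congr 1
  ring

/-- The index of the interval of length `1 / blockCount k` that contains `t`. -/
def block (t : ℝ) (k : ℕ) : ℕ := ⌊t * blockCount k⌋₊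

/-- The intervals are nested, so the residue of `block t (k + 1)` modulo `9 ^ (k + 1)` is the new
mixed-radix digit. -/
theorem block_succ_div (t : ℝ) (k : ℕ) : block t (k + 1) / 9 ^ (k + 1) = block t k := by
  rw [block, block, ← Nat.floor_div_natCast, blockCount_succ]
  congr 1
  push_cast
  rw [← mul_assoc, mul_div_cancel_right₀ _ (by positivity)]

/-- The sequence of partial quotients attached to `t`. -/
def digit (t : ℝ) (k : ℕ) : GaussianInt :=
  ⟨((3 ^ (k + 1) + block t (k + 1) % 9 ^ (k + 1) / 3 ^ (k + 1) : ℕ) : ℤ),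
    ((block t (k + 1) % 9 ^ (k + 1) % 3 ^ (k + 1) : ℕ) : ℤ)⟩

theorem digit_re_bounds (t : ℝ) (k : ℕ) :
    (3 : ℝ) ^ (k + 1) ≤ (digit t k : ℂ).re ∧ (digit t k : ℂ).re < 2 * 3 ^ (k + 1) := by
  have h : block t (k + 1) % 9 ^ (k + 1) / 3 ^ (k + 1) < 3 ^ (k + 1) := by
    apply Nat.div_lt_of_lt_mul
    rw [← mul_pow]
    exact Nat.mod_lt _ (by positivity)
  have h' : ((block t (k + 1) % 9 ^ (k + 1) / 3 ^ (k + 1) : ℕ) : ℝ) < 3 ^ (k + 1) := by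
    exact_mod_cast h
  have h0 : (0 : ℝ) ≤ ((block t (k + 1) % 9 ^ (k + 1) / 3 ^ (k + 1) : ℕ) : ℝ) := Nat.cast_nonneg _
  have : (digit t k : ℂ).re =
      3 ^ (k + 1) + ((block t (k + 1) % 9 ^ (k + 1) / 3 ^ (k + 1) : ℕ) : ℝ) := by
    rw [← GaussianInt.intCast_re, digit]
    push_cast
    rfl
  rw [this]
  constructor <;> linarith

theorem digit_im_bounds (t : ℝ) (k : ℕ) :
    0 ≤ (digit t k : ℂ).im ∧ (digit t k : ℂ).im + 1 ≤ 3 ^ (k + 1) := by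
  have h : block t (k + 1) % 9 ^ (k + 1) % 3 ^ (k + 1) + 1 ≤ 3 ^ (k + 1) :=
    Nat.mod_lt _ (by positivity)
  have : (digit t k : ℂ).im = ((block t (k + 1) % 9 ^ (k + 1) % 3 ^ (k + 1) : ℕ) : ℝ) := by
    rw [← GaussianInt.intCast_im, digit]
    push_cast
    rfl
  rw [this]
  exact ⟨Nat.cast_nonneg _, by exact_mod_cast h⟩

theorem maxNorm_digit (t : ℝ) (k : ℕ) : maxNorm (digit t k) = (digit t k : ℂ).re := by
  have h1 := digit_re_bounds t k
  have h2 := digit_im_bounds t k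
  have h3 : (0 : ℝ) < 3 ^ (k + 1) := by positivity
  rw [maxNorm, abs_of_nonneg (by linarith), abs_of_nonneg h2.1, max_eq_left (by linarith)]

theorem isLarge_digit (t : ℝ) : IsLarge (digit t) := by
  intro k
  have h : (3 : ℝ) ^ 1 ≤ 3 ^ (k + 1) := pow_le_pow_right₀ (by norm_num) (by omega)
  linarith [(digit_re_bounds t k).1, Complex.re_le_norm (digit t k : ℂ)]

theorem norm_digit_le (t : ℝ) (k : ℕ) : ‖(digit t k : ℂ)‖ + 2 / 5 ≤ 3 ^ (k + 2) := by
  have h1 := digit_re_bounds t k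
  have h2 := digit_im_bounds t k
  have h3 : (0 : ℝ) < 3 ^ (k + 1) := by positivity
  have h4 := Complex.norm_le_abs_re_add_abs_im (digit t k : ℂ)
  rw [abs_of_nonneg (by linarith), abs_of_nonneg h2.1] at h4
  -- The sum of the coordinates is below `3 * 3^(k+1) - 1`; the spare `1` covers `2/5`.
  rw [pow_succ]
  linarith

theorem block_eq_of_digit_eq {t u : ℝ} {k : ℕ} (h : block t k = block u k)
    (hd : digit t k = digit u k) : block t (k + 1) = block u (k + 1) := by
  simp only [digit, Zsqrtd.mk.injEq, Nat.cast_inj, Nat.add_left_cancel_iff] at hd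
  have hmod : block t (k + 1) % 9 ^ (k + 1) = block u (k + 1) % 9 ^ (k + 1) := by
    rw [← Nat.div_add_mod (block t (k + 1) % 9 ^ (k + 1)) (3 ^ (k + 1)), hd.1, hd.2,
      Nat.div_add_mod]
  rw [← Nat.div_add_mod (block t (k + 1)) (9 ^ (k + 1)), hmod, block_succ_div, h,
    ← block_succ_div, Nat.div_add_mod]

theorem block_eq_of_forall_digit_eq {t u : ℝ} (ht : t ∈ Set.Ico (0 : ℝ) 1)
    (hu : u ∈ Set.Ico (0 : ℝ) 1) {n : ℕ} (h : ∀ k < n, digit t k = digit u k) :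
    block t n = block u n := by
  induction n with
  | zero =>
    have : ∀ v ∈ Set.Ico (0 : ℝ) 1, block v 0 = 0 := fun v hv => by
      simp [block, blockCount, hv.2]
    rw [this t ht, this u hu]
  | succ n ih =>
    exact block_eq_of_digit_eq (ih fun k hk => h k (by omega)) (h n (by omega))

theorem abs_sub_lt_of_block_eq {t u : ℝ} (ht : 0 ≤ t) (hu : 0 ≤ u) {n : ℕ}
    (h : block t n = block u n) : |t - u| * 3 ^ (n * (n + 1)) < 1 := by
  have h1 := Nat.floor_le (a := t * blockCount n) (by positivity)
  have h2 := Nat.lt_floor_add_one (t * blockCount n)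
  have h3 := Nat.floor_le (a := u * blockCount n) (by positivity)
  have h4 := Nat.lt_floor_add_one (u * blockCount n)
  rw [block, block] at h
  rw [h] at h1 h2
  have h5 : ((3 : ℝ) ^ (n * (n + 1))) = blockCount n := by simp [blockCount]
  rw [h5, ← abs_of_nonneg (Nat.cast_nonneg (α := ℝ) (blockCount n)), ← abs_mul, abs_lt]
  constructor <;> linarith

theorem exists_digit_ne {t u : ℝ} (ht : t ∈ Set.Ico (0 : ℝ) 1) (hu : u ∈ Set.Ico (0 : ℝ) 1)
    (htu : t ≠ u) : ∃ n, digit t n ≠ digit u n := by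
  by_contra! h
  have h0 : 0 < |t - u| := abs_pos.2 (sub_ne_zero.2 htu)
  obtain ⟨n, hn⟩ := pow_unbounded_of_one_lt (|t - u|⁻¹) (by norm_num : (1 : ℝ) < 3)
  have h1 := abs_sub_lt_of_block_eq ht.1 hu.1
    (block_eq_of_forall_digit_eq ht hu (n := n) fun k _ => h k)
  have h2 : (3 : ℝ) ^ n ≤ 3 ^ (n * (n + 1)) := pow_le_pow_right₀ (by norm_num) (by nlinarith)
  have h3 : |t - u|⁻¹ < 3 ^ (n * (n + 1)) := hn.trans_le h2
  rw [inv_lt_iff_one_lt_mul₀ h0] at h3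
  linarith

theorem prod_sq_three_pow (n : ℕ) :
    ∏ k ∈ Finset.range (n + 1), ((3 : ℝ) ^ (k + 2)) ^ 2 = 3 ^ (n * (n + 1) + 4 * (n + 1)) := by
  induction n with
  | zero => norm_num
  | succ n ih =>
    rw [Finset.prod_range_succ, ih, ← pow_mul, ← pow_add]
    congr 1
    ring

theorem exists_abs_sub_le_and_le_norm {t u : ℝ} (ht : t ∈ Set.Ico (0 : ℝ) 1)
    (hu : u ∈ Set.Ico (0 : ℝ) 1) (htu : t ≠ u) : ∃ n : ℕ, |t - u| * 3 ^ (n * (n + 1)) < 1 ∧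
      1 / 5 ≤ ‖value (digit t) - value (digit u)‖ * 3 ^ (n * (n + 1) + 4 * (n + 1)) := by
  classical
  have hex := exists_digit_ne ht hu htu
  have hlt : ∀ k < Nat.find hex, digit t k = digit u k := fun k hk =>
    not_not.1 (Nat.find_min hex hk)
  refine ⟨Nat.find hex, abs_sub_lt_of_block_eq ht.1 hu.1
    (block_eq_of_forall_digit_eq ht hu hlt), ?_⟩
  rw [← prod_sq_three_pow]
  exact le_norm_value_sub _ (isLarge_digit t) (isLarge_digit u) (norm_digit_le t)
    (norm_digit_le u) hlt (Nat.find_spec hex)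

theorem le_mul_rpow_of_scale {a b s : ℝ} (hs0 : 0 < s) (hs1 : s < 1) {n : ℕ}
    (ha : a * 3 ^ (n * (n + 1)) < 1) (hb : 1 / 5 ≤ b * 3 ^ (n * (n + 1) + 4 * (n + 1))) :
    a ≤ 5 * 3 ^ (4 + 4 / (1 - s)) * b ^ s := by
  have hδ : 0 < 1 - s := by linarith
  have hn : (0 : ℝ) ≤ n := Nat.cast_nonneg n
  have ha' : a ≤ 3 ^ (-((n : ℝ) * (n + 1))) := by
    rw [Real.rpow_neg (by norm_num), ← one_div, le_div_iff₀ (by positivity)]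
    refine le_of_eq_of_le ?_ ha.le
    rw [← Real.rpow_natCast]
    push_cast
    rfl
  have hb' : 1 / 5 * (3 : ℝ) ^ (-((n : ℝ) * (n + 1) + 4 * (n + 1))) ≤ b := by
    rw [Real.rpow_neg (by norm_num), ← div_eq_mul_inv, div_le_iff₀ (by positivity)]
    refine hb.trans_eq ?_
    rw [← Real.rpow_natCast]
    push_cast
    rfl
  have hbs := Real.rpow_le_rpow (by positivity) hb' hs0.le
  rw [Real.mul_rpow (by norm_num) (by positivity), ← Real.rpow_mul (by norm_num)] at hbs
  have h5 : (1 / 5 : ℝ) ≤ (1 / 5) ^ s := by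
    simpa using Real.rpow_le_rpow_of_exponent_ge (by norm_num : (0 : ℝ) < 1 / 5) (by norm_num)
      hs1.le
  have hexp : -((n : ℝ) * (n + 1)) ≤
      4 + 4 / (1 - s) + -((n : ℝ) * (n + 1) + 4 * (n + 1)) * s := by
    -- The maximum of this quadratic, at `n = 2 / (1 - s)`, dictates the Hölder constant.
    have h1 : (4 : ℝ) * n - (1 - s) * n ^ 2 ≤ 4 / (1 - s) := by
      rw [le_div_iff₀ hδ]
      nlinarith [sq_nonneg ((1 - s) * n - 2)]
    nlinarith
  calc a ≤ 3 ^ (-((n : ℝ) * (n + 1))) := ha'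
    _ ≤ 3 ^ (4 + 4 / (1 - s) + -((n : ℝ) * (n + 1) + 4 * (n + 1)) * s) :=
      Real.rpow_le_rpow_of_exponent_le (by norm_num) hexp
    _ = 5 * 3 ^ (4 + 4 / (1 - s)) *
        (1 / 5 * 3 ^ (-((n : ℝ) * (n + 1) + 4 * (n + 1)) * s)) := by
      rw [Real.rpow_add (by norm_num)]
      ring
    _ ≤ 5 * 3 ^ (4 + 4 / (1 - s)) * b ^ s := by
      gcongr
      exact (mul_le_mul_of_nonneg_right h5 (by positivity)).trans hbs

/-! ### The dimension bound -/

theorem abs_sub_le_rpow {s : ℝ} (hs0 : 0 < s) (hs1 : s < 1) {t u : ℝ}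
    (ht : t ∈ Set.Ico (0 : ℝ) 1) (hu : u ∈ Set.Ico (0 : ℝ) 1) :
    |t - u| ≤ 5 * 3 ^ (4 + 4 / (1 - s)) * ‖value (digit t) - value (digit u)‖ ^ s := by
  rcases eq_or_ne t u with rfl | htu
  · rw [sub_self, abs_zero]
    positivity
  · obtain ⟨n, h1, h2⟩ := exists_abs_sub_le_and_le_norm ht hu htu
    exact le_mul_rpow_of_scale hs0 hs1 h1 h2

theorem injOn_value_digit : Set.InjOn (fun t => value (digit t)) (Set.Ico (0 : ℝ) 1) := by
  intro t ht u hu h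
  have := abs_sub_le_rpow (s := 1 / 2) (by norm_num) (by norm_num) ht hu
  simp only at h
  rw [h, sub_self, norm_zero, Real.zero_rpow (by norm_num), mul_zero] at this
  exact sub_eq_zero.1 (abs_nonpos_iff.1 this)

theorem le_dimH_image_value {s : ℝ≥0} (hs0 : 0 < s) (hs1 : s < 1) :
    (s : ℝ≥0∞) ≤ dimH ((fun t => value (digit t)) '' Set.Ico (0 : ℝ) 1) := by
  have hinv := injOn_value_digit.leftInvOn_invFunOn
  set f : ℝ → ℂ := fun t => value (digit t)
  have hol : HolderOnWith (5 * 3 ^ (4 + 4 / (1 - (s : ℝ)))) s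
      (Function.invFunOn f (Set.Ico (0 : ℝ) 1)) (f '' Set.Ico (0 : ℝ) 1) := by
    rintro _ ⟨t, ht, rfl⟩ _ ⟨u, hu, rfl⟩
    rw [hinv ht, hinv hu, edist_nndist, edist_nndist, ← ENNReal.coe_rpow_of_nonneg _ s.coe_nonneg,
      ← ENNReal.coe_mul, ENNReal.coe_le_coe, ← NNReal.coe_le_coe]
    push_cast
    rw [Real.dist_eq, dist_eq_norm]
    exact abs_sub_le_rpow hs0 hs1 ht hu
  have h := hol.dimH_image_le hs0
  rw [hinv.image_image, Real.dimH_of_nonempty_interior (by simp), Module.finrank_self,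
    Nat.cast_one, ENNReal.le_div_iff_mul_le (by simp [hs0.ne']) (by simp), one_mul] at h
  exact h

/-- Irrationality of the values need not be proved: `ratPoints` is countable, so it does not affect
the dimension. -/
theorem image_value_subset :
    (fun t => value (digit t)) '' Set.Ico (0 : ℝ) 1 ⊆ seedSet ∪ ratPoints := by
  rintro _ ⟨t, -, rfl⟩
  by_cases hr : value (digit t) ∈ ratPoints
  · exact Or.inr hr
  refine Or.inl ⟨⟨value_mem_U (isLarge_digit t), hr⟩, fun n hn => ?_⟩
  obtain ⟨k, rfl⟩ := Nat.exists_eq_add_of_le' hn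
  rw [partialQuotient, Nat.add_sub_cancel, nearest_inv_iterate_hurwitzMap k (isLarge_digit t),
    maxNorm_digit]
  exact digit_re_bounds t k

theorem one_le_dimH_seedSet : 1 ≤ dimH seedSet := by
  have h := dimH_mono image_value_subset
  rw [dimH_union, countable_ratPoints.dimH_zero, max_eq_left zero_le] at h
  refine le_of_forall_lt fun r hr => ?_
  obtain ⟨s, hrs, hs1⟩ := ENNReal.lt_iff_exists_nnreal_btwn.1 hr
  have hs0 : 0 < s := by exact_mod_cast (zero_le (a := r)).trans_lt hrs
  exact hrs.trans_le ((le_dimH_image_value hs0 (by exact_mod_cast hs1)).trans h)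

end Hurwitz

end

theorem mainTheorem2 :
    Hurwitz.seedSet ⊆ Hurwitz.E ∧ 1 ≤ dimH Hurwitz.seedSet :=
  ⟨Hurwitz.seedSet_subset_E, Hurwitz.one_le_dimH_seedSet⟩
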